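/- **Theorem 1.** Consider a linear plant $\dot X = AX + B_1U + B_2W$, $Y = CX$ with real matrices, a weighting filter (LCL roll-off weight) $\dot X_\omega = A_\omega X_\omega + B_\omega C_Q C X$, $Y_\omega = C_\omega X_\omega + D_\omega C_Q C X$, and the integral of the tracking error $e = Y_{ref} - CX$. With the augmented state $\bar X=(X, X_\omega, \int e\,dt)$ and the disturbance $\bar W=(W, Y_{ref})$, consider the augmented system $$\dot{\bar X} = \bar A\bar X + \bar B_1U + \bar B_2\bar W,\qquad \bar Y = \bar C\bar X + \bar D_1U,$$ $$\bar A=\begin{bmatrix}A&0&0\\ B_\omega C_QC&A_\omega&0\\ -C&0&0\end{bmatrix},\quad \bar B_1=\begin{bmatrix}B_1\\0\\0\end{bmatrix},\quad \bar B_2=\begin{bmatrix}B_2&0\\0&0\\0&I\end{bmatrix},\quad \bar C=\begin{bmatrix}-C&0&0\\ D_\omega C_QC&C_\omega&0\end{bmatrix},$$ where $\bar D_1$ is any real matrix of compatible size, for instance $\begin{bmatrix}0&I\\0&0\end{bmatrix}$. For a static state feedback $U=\bar K\bar X$, call $\bar K$ stabilizing if all eigenvalues of $\bar A+\bar B_1\bar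 K$ have negative real part, and let $$G_{\bar K}(s)=(\bar C+\bar D_1\bar K)\bigl(sI-(\bar A+\bar B_1\bar K)\bigr)^{-1}\bar B_2,\qquad \|G_{\bar K}\|_\infty=\sup_{\omega\in\mathbb R}\sigma_{\max}\bigl(G_{\bar K}(i\omega)\bigr).$$ For $\gamma>0$, consider the linear matrix inequality (LMI) in a symmetric positive definite matrix $X_P$ and a matrix $W_P$ $$\begin{bmatrix}\Psi&\bar B_2&(\bar CX_P+\bar D_1W_P)^T\\ \bar B_2^T&-\gamma I&0\\ \bar CX_P+\bar D_1W_P&0&-\gamma I\end{bmatrix}<0,\qquad \Psi=(\bar AX_P+\bar B_1W_P)^T+\bar AX_P+\bar B_1W_P .$$ Then: 1. For every $\gamma>0$, there is a stabilizing $\bar K$ with $\|G_{\bar K}\|_\infty<\gamma$ if and only if there are a symmetric positive definite $X_P$ and a matrix $W_P$ that satisfy the LMI. 2. For every $\gamma>0$ and every such pair $(X_P,W_P)$, the gain $\bar K=W_PX_P^{-1}$ is stabilizing and satisfies $\|G_{\bar K}\|_\infty<\gamma$. 3. The infimum of the $\gamma>0$ for which the LMI has such a solution equals the infimum of $\|G_{\bar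 K}\|_\infty$ over all stabilizing $\bar K$ (both are $+\infty$ if there is none). -/

import Mathlib

open scoped Matrix ENNReal

namespace HinfControl

/-- Real matrices of a linear system with control input `U` and disturbance `W`:
`X' = A X + B₁ U + B₂ W`, `Y = C X + D₁ U`.
The index types `ν`, `μ`, `δ`, `κ` are those of state, input, disturbance and output. -/
structure LinSystem (ν μ δ κ : Type*) where
  A : Matrix ν ν ℝ
  B₁ : Matrix ν μ ℝ
  B₂ : Matrix ν δ ℝ
  C : Matrix κ ν ℝ
  D₁ : Matrix κ μ ℝ

/-- A real square matrix is Hurwitz if all its complex eigenvalues have negative real part. -/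
def IsHurwitz {ν : Type*} [Fintype ν] [DecidableEq ν] (M : Matrix ν ν ℝ) : Prop :=
  ∀ z ∈ spectrum ℂ (M.map Complex.ofReal), z.re < 0

/-- The largest singular value of a complex matrix, as its operator norm between
Euclidean spaces. -/
noncomputable def sigmaMax {κ δ : Type*} [Fintype κ] [Fintype δ] [DecidableEq δ]
    (M : Matrix κ δ ℂ) : ℝ :=
  ‖LinearMap.toContinuousLinearMap (Matrix.toEuclideanLin M)‖

/-- The H-infinity norm `sup_ω σ_max (G (i ω))` of the transfer matrix `G` of a stable system,
as an extended nonnegative real number. -/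
noncomputable def hinfNorm {κ δ : Type*} [Fintype κ] [Fintype δ] [DecidableEq δ]
    (G : ℂ → Matrix κ δ ℂ) : ℝ≥0∞ :=
  ⨆ ω : ℝ, ENNReal.ofReal (sigmaMax (G (Complex.I * (ω : ℂ))))

namespace LinSystem

variable {ν μ δ κ : Type*} [Fintype ν] [DecidableEq ν] [Fintype μ]
  [Fintype δ] [DecidableEq δ] [Fintype κ] [DecidableEq κ]

/-- The feedback `U = K X` is stabilizing. -/
def IsStabilizing (S : LinSystem ν μ δ κ) (K : Matrix μ ν ℝ) : Prop :=
  IsHurwitz (S.A + S.B₁ * K)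

/-- Closed-loop transfer matrix from disturbance to output,
`G(s) = (C + D₁ K) (s I - (A + B₁ K))⁻¹ B₂`. -/
noncomputable def transfer (S : LinSystem ν μ δ κ) (K : Matrix μ ν ℝ) (s : ℂ) :
    Matrix κ δ ℂ :=
  (S.C + S.D₁ * K).map Complex.ofReal *
    (s • (1 : Matrix ν ν ℂ) - (S.A + S.B₁ * K).map Complex.ofReal)⁻¹ *
      S.B₂.map Complex.ofReal

/-- `K` solves the H-infinity problem at level `γ`: the feedback `U = K X` is stabilizing and
the closed-loop H-infinity norm is smaller than `γ`. -/
def Solves (S : LinSystem ν μ δ κ) (γ : ℝ) (K : Matrix μ ν ℝ) : Prop :=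
  S.IsStabilizing K ∧ hinfNorm (S.transfer K) < ENNReal.ofReal γ

/-- `Ψ = (A X + B₁ W)ᵀ + A X + B₁ W`. -/
def Psi (S : LinSystem ν μ δ κ) (X : Matrix ν ν ℝ) (W : Matrix μ ν ℝ) : Matrix ν ν ℝ :=
  (S.A * X + S.B₁ * W)ᵀ + S.A * X + S.B₁ * W

/-- The symmetric matrix
`[Ψ, B₂, (C X + D₁ W)ᵀ; B₂ᵀ, -γ I, 0; C X + D₁ W, 0, -γ I]`. -/
def lmiMatrix (S : LinSystem ν μ δ κ) (γ : ℝ) (X : Matrix ν ν ℝ) (W : Matrix μ ν ℝ) :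
    Matrix ((ν ⊕ δ) ⊕ κ) ((ν ⊕ δ) ⊕ κ) ℝ :=
  Matrix.fromBlocks
    (Matrix.fromBlocks (S.Psi X W) S.B₂ S.B₂ᵀ (-(γ • (1 : Matrix δ δ ℝ))))
    (Matrix.fromRows (S.C * X + S.D₁ * W)ᵀ 0)
    (Matrix.fromCols (S.C * X + S.D₁ * W) 0)
    (-(γ • (1 : Matrix κ κ ℝ)))

/-- The pair `(X, W)` is feasible at level `γ`: `X` is symmetric positive definite and the
matrix of the linear matrix inequality is negative definite. -/
def Feasible (S : LinSystem ν μ δ κ) (γ : ℝ) (X : Matrix ν ν ℝ) (W : Matrix μ ν ℝ) : Prop :=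
  X.PosDef ∧ (-(S.lmiMatrix γ X W)).PosDef

end LinSystem

/-- The plant `X' = A X + B₁ U + B₂ W`, `Y = C X`, augmented with the roll-off weight
`Xω' = Aω Xω + Bω CQ C X`, `Yω = Cω Xω + Dω CQ C X` and with the integral of the tracking
error `e = Yref - C X`. The augmented state is `(X, Xω, ∫ e)`, the disturbance is `(W, Yref)`,
and the output has the state part `(-C X, Cω Xω + Dω CQ C X)` and the input part `D₁ U`. -/
def augmented {n m w p q f r : Type*} [Fintype n] [Fintype p] [DecidableEq p] [Fintype q]
    (A : Matrix n n ℝ) (B₁ : Matrix n m ℝ) (B₂ : Matrix n w ℝ) (C : Matrix p n ℝ)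
    (CQ : Matrix q p ℝ) (Aω : Matrix f f ℝ) (Bω : Matrix f q ℝ)
    (Cω : Matrix r f ℝ) (Dω : Matrix r q ℝ) (D₁ : Matrix (p ⊕ r) m ℝ) :
    LinSystem ((n ⊕ f) ⊕ p) m (w ⊕ p) (p ⊕ r) where
  A := Matrix.fromBlocks
    (Matrix.fromBlocks A 0 (Bω * CQ * C) Aω) 0
    (Matrix.fromCols (-C) 0) 0
  B₁ := Matrix.fromRows (Matrix.fromRows B₁ 0) 0
  B₂ := Matrix.fromBlocks (Matrix.fromRows B₂ 0) 0 0 1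
  C := Matrix.fromRows
    (Matrix.fromCols (Matrix.fromCols (-C) 0) 0)
    (Matrix.fromCols (Matrix.fromCols (Dω * CQ * C) Cω) 0)
  D₁ := D₁

end HinfControl

/-!
For a gain `K`, put `M = A + B₁ K` and `C' = C + D₁ K`. With `W = K X`, which is no restriction
because `X` is invertible, the linear matrix inequality becomes the bounded real inequality of the
closed loop `(M, B₂, C')` (`LinSystem.lmiMatrix_mul`). The theorem is thus the strict bounded real
lemma: `M` is Hurwitz with `H∞` norm below `γ` if and only if that inequality has a positive
definite solution `X`. The block structure of the augmented plant plays no role.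

If `X` is a solution, an eigenvector `X u` of `M` makes the form at `(u, 0, 0)` equal to
`2 Re z · u* X u < 0`, whence stability. At `(u, a, γ⁻¹ y)` with `X u = (i ω - M)⁻¹ B₂ a` and
`y = C' X u` the state terms cancel, and the form compares `|y|²` with `γ² |a|²`. A margin `ε` in the
matrix inequality makes the resulting bound uniform in `ω`.

For the converse one needs a symmetric `P` with
`γ⁻¹ |C' x|² - γ |a|² + 2 Re (x* P (M x + B₂ a)) < 0` for `(x, a) ≠ 0`, that is,
`Θ + Eᵀ P F + Fᵀ P E < 0` with `E = [1 0]` and `F = [M B₂]`. If there is none, Hahn–Banach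
separation gives a nonzero positive semidefinite `Z = S Sᵀ` with `F Z Eᵀ + E Z Fᵀ = 0` and
`tr (Θ Z) ≥ 0` (`exists_dual_of_not_exists`). The equation makes `(E S + F S)ᴴ` and
`(E S - F S)ᴴ` differ by a unitary matrix, and diagonalizing it writes `Z` as a sum of `z z*` over
vectors with `F z = i ω E z` or `E z = 0` (`exists_orthonormalBasis_frequency`). On these, `Θ` is
negative because the gain at each frequency is below `γ`, a contradiction
(`exists_isSymm_posDef_of_frequency`). Stability of `M` then makes `P` positive definite
(`posDef_of_lyapunov`), and `X = P⁻¹` solves the bounded real inequality.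

The equality of the infima follows from the equivalence at each level `γ`.
-/

namespace HinfControl

open Filter Topology
open scoped ComplexOrder

/-! ### Complexification of real matrices -/

section Complexification

variable {α β γ : Type*}

theorem map_ofReal_mul [Fintype β] (M : Matrix α β ℝ) (N : Matrix β γ ℝ) :
    (M * N).map Complex.ofReal = M.map Complex.ofReal * N.map Complex.ofReal :=
  Matrix.map_mul (f := Complex.ofRealHom)

theorem map_ofReal_conjTranspose (M : Matrix α β ℝ) :
    (M.map Complex.ofReal)ᴴ = Mᵀ.map Complex.ofReal := by
  ext i j
  simp

theorem trace_map_ofReal [Fintype α] (M : Matrix α α ℝ) :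
    (M.map Complex.ofReal).trace = (M.trace : ℂ) := by
  simp [Matrix.trace]

end Complexification

/-! ### Hermitian forms on complex vectors -/

section Forms

theorem star_mulVec_dotProduct_mulVec {κ ν : Type*} [Fintype κ] [Fintype ν] (S : Matrix κ ν ℂ)
    (P : Matrix κ κ ℂ) (x : ν → ℂ) :
    star (S *ᵥ x) ⬝ᵥ P *ᵥ (S *ᵥ x) = star x ⬝ᵥ (Sᴴ * P * S) *ᵥ x := by
  rw [Matrix.star_mulVec, ← Matrix.mulVec_mulVec, ← Matrix.mulVec_mulVec,
    Matrix.dotProduct_mulVec (star x) Sᴴ]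

theorem re_star_dotProduct_transpose_mulVec {κ ν : Type*} [Fintype κ] [Fintype ν]
    (N : Matrix κ ν ℝ) (a : ν → ℂ) (b : κ → ℂ) :
    (star a ⬝ᵥ Nᵀ.map Complex.ofReal *ᵥ b).re = (star b ⬝ᵥ N.map Complex.ofReal *ᵥ a).re := by
  rw [← map_ofReal_conjTranspose, Matrix.dotProduct_mulVec, ← Matrix.star_mulVec,
    Matrix.star_dotProduct, Complex.star_def, Complex.conj_re]

theorem re_star_dotProduct_self {ι : Type*} [Fintype ι] (v : ι → ℂ) :
    (star v ⬝ᵥ v).re = ‖WithLp.toLp 2 v‖ ^ 2 := by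
  rw [EuclideanSpace.norm_sq_eq, dotProduct, Complex.re_sum]
  refine Finset.sum_congr rfl fun i _ => ?_
  rw [← Complex.normSq_eq_norm_sq, Complex.normSq_apply]
  simp

theorem two_mul_re_star_dotProduct_le {ι : Type*} [Fintype ι] {γ : ℝ} (hγ : 0 < γ)
    (b y : ι → ℂ) :
    2 * (star b ⬝ᵥ y).re ≤ γ * (star b ⬝ᵥ b).re + γ⁻¹ * (star y ⬝ᵥ y).re := by
  have h1 : 0 ≤ (star ((γ : ℂ) • b - y) ⬝ᵥ ((γ : ℂ) • b - y)).re := by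
    rw [re_star_dotProduct_self]
    positivity
  have h2 : (star y ⬝ᵥ b).re = (star b ⬝ᵥ y).re := by
    rw [Matrix.star_dotProduct, Complex.star_def, Complex.conj_re]
  have h3 : (star ((γ : ℂ) • b - y) ⬝ᵥ ((γ : ℂ) • b - y)).re =
      γ * (γ * (star b ⬝ᵥ b).re) - 2 * γ * (star b ⬝ᵥ y).re + (star y ⬝ᵥ y).re := by
    simp only [star_sub, star_smul, sub_dotProduct, dotProduct_sub, smul_dotProduct,
      dotProduct_smul, smul_eq_mul, Complex.star_def, Complex.conj_ofReal, Complex.sub_re,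
      Complex.re_ofReal_mul, h2]
    ring
  rw [h3] at h1
  have h4 := mul_nonneg (inv_nonneg.2 hγ.le) h1
  have h5 : γ⁻¹ * (γ * (γ * (star b ⬝ᵥ b).re) - 2 * γ * (star b ⬝ᵥ y).re + (star y ⬝ᵥ y).re) =
      γ * (star b ⬝ᵥ b).re - 2 * (star b ⬝ᵥ y).re + γ⁻¹ * (star y ⬝ᵥ y).re := by
    field_simp
  linarith

theorem re_star_dotProduct_self_pos {ι : Type*} [Fintype ι] {v : ι → ℂ} (hv : v ≠ 0) :
    0 < (star v ⬝ᵥ v).re := by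
  rw [re_star_dotProduct_self]
  have : WithLp.toLp 2 v ≠ 0 := by simpa using hv
  positivity

theorem re_star_dotProduct_self_nonneg {ι : Type*} [Fintype ι] (v : ι → ℂ) :
    0 ≤ (star v ⬝ᵥ v).re := by
  rw [re_star_dotProduct_self]
  positivity

end Forms

/-! ### Positive definite matrices -/

section PosDef

variable {ι : Type*} [Fintype ι]

/-- Symmetry of the matrices is not required, so that the set is open in the space of all
matrices. -/
theorem isOpen_setOf_quadratic_pos :
    IsOpen {N : Matrix ι ι ℝ | ∀ x : ι → ℝ, x ≠ 0 → 0 < x ⬝ᵥ N *ᵥ x} := by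
  have key : {N : Matrix ι ι ℝ | ∀ x : ι → ℝ, x ≠ 0 → 0 < x ⬝ᵥ N *ᵥ x} =
      {N | ∀ x ∈ Metric.sphere (0 : ι → ℝ) 1, 0 < x ⬝ᵥ N *ᵥ x} := by
    ext N
    refine ⟨fun h x hx => h x fun h0 => by simp [h0] at hx, fun h x hx => ?_⟩
    have hn : 0 < ‖x‖ := norm_pos_iff.2 hx
    have := h (‖x‖⁻¹ • x) (by simp [norm_smul, hn.ne'])
    simp only [Matrix.mulVec_smul, smul_dotProduct, dotProduct_smul, smul_eq_mul] at this
    have h2 : 0 < ‖x‖⁻¹ := inv_pos.2 hn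
    exact pos_of_mul_pos_right (pos_of_mul_pos_right this h2.le) h2.le
  rw [key, isOpen_iff_mem_nhds]
  intro N hN
  refine (isCompact_sphere (0 : ι → ℝ) 1).eventually_forall_of_forall_eventually fun x hx => ?_
  have hc : Continuous fun q : Matrix ι ι ℝ × (ι → ℝ) => q.2 ⬝ᵥ q.1 *ᵥ q.2 := by fun_prop
  exact hc.continuousAt.eventually (lt_mem_nhds (hN x hx))

theorem _root_.Matrix.PosDef.exists_sub_smul_one [DecidableEq ι] {N : Matrix ι ι ℝ}
    (hN : N.PosDef) : ∃ ε : ℝ, 0 < ε ∧ (N - ε • (1 : Matrix ι ι ℝ)).PosDef := by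
  have hc : Continuous fun ε : ℝ => N - ε • (1 : Matrix ι ι ℝ) := by fun_prop
  have h0 : N - (0 : ℝ) • (1 : Matrix ι ι ℝ) ∈
      {N : Matrix ι ι ℝ | ∀ x : ι → ℝ, x ≠ 0 → 0 < x ⬝ᵥ N *ᵥ x} := by
    intro x hx
    simpa using hN.dotProduct_mulVec_pos hx
  have h1 := hc.continuousAt.eventually (isOpen_setOf_quadratic_pos.mem_nhds h0)
  obtain ⟨ε, hε, hpos⟩ := ((h1.filter_mono nhdsWithin_le_nhds).and
    (self_mem_nhdsWithin : Set.Ioi (0 : ℝ) ∈ 𝓝[>] 0)).exists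
  refine ⟨ε, hpos, .of_dotProduct_mulVec_pos ?_ fun {x} hx => by simpa using hε x hx⟩
  exact hN.1.sub (by simp [Matrix.IsHermitian])

theorem posDef_map_ofReal_iff {N : Matrix ι ι ℝ} :
    (N.map Complex.ofReal).PosDef ↔ N.PosDef := by
  constructor
  · intro h
    refine .of_dotProduct_mulVec_pos ?_ fun {x} hx => ?_
    · have := h.1
      ext i j
      simpa using congr_fun (congr_fun this i) j
    · have := h.dotProduct_mulVec_pos (x := fun i => (x i : ℂ))
        (fun h0 => hx (funext fun i => by simpa using congr_fun h0 i))
      have e : star (fun i => (x i : ℂ)) ⬝ᵥ N.map Complex.ofReal *ᵥ (fun i => (x i : ℂ)) =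
          ((star x ⬝ᵥ N *ᵥ x : ℝ) : ℂ) := by
        simp [dotProduct, Matrix.mulVec]
      rw [e] at this
      exact_mod_cast this
  · intro h
    have hH : (N.map Complex.ofReal).IsHermitian := by
      ext i j
      simpa using congr_fun (congr_fun h.1 i) j
    refine .of_dotProduct_mulVec_pos hH fun {x} hx => ?_
    have him := hH.im_star_dotProduct_mulVec_self x
    have hre : (star x ⬝ᵥ N.map Complex.ofReal *ᵥ x).re =
        star (fun i => (x i).re) ⬝ᵥ N *ᵥ (fun i => (x i).re) +
        star (fun i => (x i).im) ⬝ᵥ N *ᵥ (fun i => (x i).im) := by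
      simp [dotProduct, Matrix.mulVec, Finset.sum_add_distrib]
    have hnn : ∀ v : ι → ℝ, 0 ≤ star v ⬝ᵥ N *ᵥ v := h.posSemidef.dotProduct_mulVec_nonneg
    rw [Complex.pos_iff]
    refine ⟨?_, him.symm⟩
    rw [hre]
    by_cases h1 : (fun i => (x i).re) = 0
    · have h2 : (fun i => (x i).im) ≠ 0 := fun h2 => hx <| funext fun i =>
        Complex.ext (congr_fun h1 i) (congr_fun h2 i)
      exact add_pos_of_nonneg_of_pos (hnn _) (h.dotProduct_mulVec_pos h2)
    · exact add_pos_of_pos_of_nonneg (h.dotProduct_mulVec_pos h1) (hnn _)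

end PosDef

/-! ### Isometries and normal operators -/

section Unitary

/-- The isometry is determined by `G x ↦ H x` on the range of `G`; finite dimension extends it to
the whole space. -/
theorem exists_linearIsometry_apply_eq {V W : Type*} [AddCommGroup W] [Module ℂ W]
    [NormedAddCommGroup V] [InnerProductSpace ℂ V] [FiniteDimensional ℂ V]
    (G H : W →ₗ[ℂ] V) (h : ∀ x, ‖H x‖ = ‖G x‖) :
    ∃ U : V →ₗᵢ[ℂ] V, ∀ x, U (G x) = H x := by
  have hk : G.ker ≤ H.ker := fun x hx => by
    rw [LinearMap.mem_ker] at hx ⊢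
    rw [← norm_eq_zero, h, hx, norm_zero]
  let T : G.range →ₗ[ℂ] V := (G.ker.liftQ H hk) ∘ₗ G.quotKerEquivRange.symm.toLinearMap
  have hT : ∀ x, T ⟨G x, LinearMap.mem_range_self G x⟩ = H x := fun x => by
    have : G.quotKerEquivRange.symm ⟨G x, LinearMap.mem_range_self G x⟩ = G.ker.mkQ x :=
      G.quotKerEquivRange_symm_apply_image x _
    simp [T, this]
  let L : G.range →ₗᵢ[ℂ] V := ⟨T, by
    rintro ⟨_, x, rfl⟩
    exact (congrArg norm (hT x)).trans (h x)⟩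
  exact ⟨L.extend, fun x => (L.extend_apply ⟨G x, _⟩).trans (hT x)⟩

theorem exists_orthonormalBasis_eigenvector {V : Type*}
    [NormedAddCommGroup V] [InnerProductSpace ℂ V] [FiniteDimensional ℂ V]
    (T : V →L[ℂ] V) [IsStarNormal T] :
    ∃ b : OrthonormalBasis (Fin (Module.finrank ℂ V)) ℂ V, ∀ i, ∃ z : ℂ, T (b i) = z • b i := by
  classical
  have hA : ((realPart T : V →L[ℂ] V) : V →ₗ[ℂ] V).IsSymmetric :=
    (realPart T).2.isSymmetric
  have hB : ((imaginaryPart T : V →L[ℂ] V) : V →ₗ[ℂ] V).IsSymmetric :=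
    (imaginaryPart T).2.isSymmetric
  have hAB : Commute ((realPart T : V →L[ℂ] V) : V →ₗ[ℂ] V)
      ((imaginaryPart T : V →L[ℂ] V) : V →ₗ[ℂ] V) := by
    have := Commute.realPart_imaginaryPart T
    exact congrArg (fun S : V →L[ℂ] V => (S : V →ₗ[ℂ] V)) this
  have key : ∀ (v : V) (a c : ℂ), (realPart T : V →L[ℂ] V) v = a • v →
      (imaginaryPart T : V →L[ℂ] V) v = c • v → ∃ z : ℂ, T v = z • v := by
    intro v a c h1 h2
    refine ⟨a + Complex.I * c, ?_⟩
    conv_lhs => rw [← realPart_add_I_smul_imaginaryPart T]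
    rw [add_apply, smul_apply, h1, h2, add_smul, mul_smul]
  have hint := hA.directSum_isInternal_of_commute hB hAB
  have horth := hA.orthogonalFamily_eigenspace_inf_eigenspace hB
  let _ := hint.submodule_iSupIndep.fintypeNeBotOfFiniteDimensional
  -- Only finitely many pairs `(a, c)` have a nonzero joint eigenspace; restricting to them makes
  -- the index set finite.
  have hint' := (DirectSum.isInternal_ne_bot_iff).2 hint
  have horth' := horth.comp (Subtype.val_injective (p := fun i : ℂ × ℂ =>
    (Module.End.eigenspace ((realPart T : V →L[ℂ] V) : V →ₗ[ℂ] V) i.2 ⊓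
      Module.End.eigenspace ((imaginaryPart T : V →L[ℂ] V) : V →ₗ[ℂ] V) i.1) ≠ ⊥))
  refine ⟨hint'.subordinateOrthonormalBasis rfl horth', fun i => ?_⟩
  have hmem := hint'.subordinateOrthonormalBasis_subordinate rfl i horth'
  obtain ⟨h1, h2⟩ := Submodule.mem_inf.1 hmem
  rw [Module.End.mem_eigenspace_iff] at h1 h2
  exact key _ _ _ h1 h2

end Unitary

/-! ### Splitting a degenerate Lagrange multiplier into pure frequencies -/

section Frequency

variable {ν ι κ : Type*} [Fintype ν] [Fintype ι] [Fintype κ]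

/-- The Cayley transform maps the unit circle to the imaginary axis. At `c = -1` the division by
zero makes both sides `0`. -/
theorem cayley_eq_I_mul_ofReal {c : ℂ} (hc : ‖c‖ = 1) :
    (c - 1) / (c + 1) = Complex.I * ((((c - 1) / (c + 1)).im : ℝ) : ℂ) := by
  have hre : ((c - 1) / (c + 1)).re = 0 := by
    have h1 : c.re * c.re + c.im * c.im = 1 := by
      rw [← Complex.normSq_apply, Complex.normSq_eq_norm_sq, hc, one_pow]
    rw [Complex.div_re, ← add_div]
    have : (c - 1).re * (c + 1).re + (c - 1).im * (c + 1).im = 0 := by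
      simp
      linarith
    rw [this, zero_div]
  apply Complex.ext <;> simp [hre]

/-- If `Y Xᴴ` is skew-Hermitian, then an orthonormal change of columns makes each column of `Y` a
purely imaginary multiple of that of `X`, the multiple `∞` meaning that the column of `X`
vanishes. The hypothesis says that `(X + Y)ᴴ` and `(X - Y)ᴴ` have the same Gram matrix, so they
differ by a unitary matrix; the basis consists of its eigenvectors. -/
theorem exists_orthonormalBasis_frequency [DecidableEq ι] (X Y : Matrix ν ι ℂ)
    (h : Y * Xᴴ + X * Yᴴ = 0) :
    ∃ b : OrthonormalBasis (Fin (Module.finrank ℂ (EuclideanSpace ℂ ι))) ℂ (EuclideanSpace ℂ ι),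
      ∀ i, X *ᵥ (b i).ofLp = 0 ∨
        ∃ ω : ℝ, Y *ᵥ (b i).ofLp = (Complex.I * (ω : ℂ)) • X *ᵥ (b i).ofLp := by
  classical
  set G : EuclideanSpace ℂ ν →ₗ[ℂ] EuclideanSpace ℂ ι := Matrix.toEuclideanLin (X - Y)ᴴ with hG
  set H : EuclideanSpace ℂ ν →ₗ[ℂ] EuclideanSpace ℂ ι := Matrix.toEuclideanLin (X + Y)ᴴ with hH
  have hGH : (X + Y) * (X + Y)ᴴ = (X - Y) * (X - Y)ᴴ := by
    have : (X + Y) * (X + Y)ᴴ = (X - Y) * (X - Y)ᴴ + (2 : ℂ) • (Y * Xᴴ + X * Yᴴ) := by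
      simp only [Matrix.conjTranspose_add, Matrix.conjTranspose_sub, Matrix.add_mul,
        Matrix.mul_add, Matrix.sub_mul, Matrix.mul_sub, two_smul]
      abel
    rw [this, h, smul_zero, add_zero]
  have hnorm : ∀ x, ‖H x‖ = ‖G x‖ := by
    intro x
    have aux : ∀ M : Matrix ν ι ℂ, ((‖Matrix.toEuclideanLin Mᴴ x‖ ^ 2 : ℝ) : ℂ) =
        star x.ofLp ⬝ᵥ (M * Mᴴ) *ᵥ x.ofLp := by
      intro M
      have := inner_self_eq_norm_sq_to_K (𝕜 := ℂ) (Matrix.toEuclideanLin Mᴴ x)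
      push_cast
      refine Eq.trans this.symm ?_
      rw [EuclideanSpace.inner_eq_star_dotProduct, Matrix.ofLp_toLpLin, Matrix.toLin'_apply,
        ← Matrix.mulVec_mulVec, dotProduct_comm, Matrix.star_mulVec,
        Matrix.conjTranspose_conjTranspose,
        Matrix.dotProduct_mulVec (star x.ofLp) M]
    have h2 : ‖H x‖ ^ 2 = ‖G x‖ ^ 2 := by
      have := (aux (X + Y)).trans ((congrArg (fun N => star x.ofLp ⬝ᵥ N *ᵥ x.ofLp) hGH).trans
        (aux (X - Y)).symm)
      exact_mod_cast this
    exact (sq_eq_sq₀ (norm_nonneg _) (norm_nonneg _)).1 h2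
  obtain ⟨U, hU⟩ := exists_linearIsometry_apply_eq G H hnorm
  let e : EuclideanSpace ℂ ι ≃ₗᵢ[ℂ] EuclideanSpace ℂ ι := U.toLinearIsometryEquiv rfl
  let T : EuclideanSpace ℂ ι →L[ℂ] EuclideanSpace ℂ ι :=
    e.toContinuousLinearEquiv.toContinuousLinearMap
  have hadj : star T = e.symm.toContinuousLinearEquiv.toContinuousLinearMap :=
    e.adjoint_eq_symm
  have hT : IsStarNormal T := ⟨by
    rw [hadj]
    ext x : 1
    simp [T]⟩
  obtain ⟨b, hb⟩ := exists_orthonormalBasis_eigenvector T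
  refine ⟨b, fun i => ?_⟩
  obtain ⟨z, hz⟩ := hb i
  have hz1 : ‖z‖ = 1 := by
    have h1 : ‖T (b i)‖ = ‖b i‖ := e.norm_map (b i)
    rw [hz, norm_smul, b.norm_eq_one i, mul_one] at h1
    exact h1
  have hz0 : z ≠ 0 := norm_ne_zero_iff.1 (by rw [hz1]; exact one_ne_zero)
  have hsymm : e.symm (b i) = z⁻¹ • b i := by
    rw [LinearIsometryEquiv.symm_apply_eq, map_smul]
    change b i = z⁻¹ • T (b i)
    rw [hz, smul_smul, inv_mul_cancel₀ hz0, one_smul]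
  have hmain : Matrix.toEuclideanLin (X + Y) (b i) = z⁻¹ • Matrix.toEuclideanLin (X - Y) (b i) := by
    refine ext_inner_left ℂ fun w => ?_
    have hl : ∀ M : Matrix ν ι ℂ, ∀ v, inner ℂ w (Matrix.toEuclideanLin M v) =
        inner ℂ (Matrix.toEuclideanLin Mᴴ w) v := fun M v => by
      rw [Matrix.toEuclideanLin_conjTranspose_eq_adjoint, LinearMap.adjoint_inner_left]
    rw [inner_smul_right, hl, hl, ← hH, ← hG, ← inner_smul_right, ← hsymm, ← hU]
    exact (e.inner_map_eq_flip (G w) (b i))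
  have hvec : (X + Y) *ᵥ (b i).ofLp = z⁻¹ • (X - Y) *ᵥ (b i).ofLp := by
    have := congrArg WithLp.ofLp hmain
    rwa [Matrix.ofLp_toLpLin, WithLp.ofLp_smul, Matrix.ofLp_toLpLin] at this
  -- With `c = z⁻¹` this reads `(1 + c) y = (c - 1) x`.
  rw [Matrix.add_mulVec, Matrix.sub_mulVec, smul_sub] at hvec
  generalize X *ᵥ (b i).ofLp = x at hvec ⊢
  generalize Y *ᵥ (b i).ofLp = y at hvec ⊢
  have hc1 : ‖z⁻¹‖ = 1 := by rw [norm_inv, hz1, inv_one]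
  generalize z⁻¹ = c at hvec hc1
  by_cases hc : c + 1 = 0
  · left
    have hc' : c = -1 := eq_neg_of_add_eq_zero_left hc
    rw [hc', neg_one_smul, neg_one_smul] at hvec
    have h2 : (2 : ℂ) • x = 0 := by
      rw [two_smul]
      have := congrArg (fun v => v + x - y) hvec
      calc x + x = x + y + x - y := by abel
        _ = -x - -y + x - y := this
        _ = 0 := by abel
    exact (smul_eq_zero.1 h2).resolve_left two_ne_zero
  · right
    refine ⟨((c - 1) / (c + 1)).im, ?_⟩
    rw [← cayley_eq_I_mul_ofReal hc1]
    ext j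
    have hj := congr_fun hvec j
    simp only [Pi.add_apply, Pi.sub_apply, Pi.smul_apply, smul_eq_mul] at hj ⊢
    rw [div_mul_eq_mul_div, eq_div_iff hc]
    linear_combination hj

theorem sum_dotProduct_mulVec_eq_trace [DecidableEq ι] {m : Type*} [Fintype m]
    (b : OrthonormalBasis m ℂ (EuclideanSpace ℂ ι)) (S : Matrix κ ι ℂ) (Θ : Matrix κ κ ℂ) :
    ∑ i, star (S *ᵥ (b i).ofLp) ⬝ᵥ Θ *ᵥ (S *ᵥ (b i).ofLp) = (Θ * (S * Sᴴ)).trace := by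
  have h1 : LinearMap.trace ℂ _ (Matrix.toEuclideanLin (Sᴴ * Θ * S)) = (Sᴴ * Θ * S).trace := by
    change LinearMap.trace ℂ _ (Matrix.toLpLin 2 2 (Sᴴ * Θ * S)) = _
    rw [Matrix.toLpLin_eq_toLin,
      LinearMap.trace_eq_matrix_trace ℂ (PiLp.basisFun 2 ℂ ι), LinearMap.toMatrix_toLin]
  rw [← Matrix.mul_assoc, Matrix.trace_mul_comm, ← Matrix.mul_assoc, ← h1,
    LinearMap.trace_eq_sum_inner _ b]
  refine Finset.sum_congr rfl fun i _ => ?_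
  rw [EuclideanSpace.inner_eq_star_dotProduct, Matrix.ofLp_toLpLin, Matrix.toLin'_apply, Matrix.star_mulVec,
    ← Matrix.mulVec_mulVec, ← Matrix.mulVec_mulVec, dotProduct_comm _ (star _)]
  conv_rhs => rw [Matrix.dotProduct_mulVec]

end Frequency

/-! ### The Kalman–Yakubovich–Popov lemma -/

section KYP

variable {ν ι : Type*} [Fintype ν] [Fintype ι]

theorem exists_trace_mul_eq [DecidableEq ι] (f : Matrix ι ι ℝ →ₗ[ℝ] ℝ) :
    ∃ Z : Matrix ι ι ℝ, ∀ N, f N = (N * Z).trace := by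
  refine ⟨Matrix.of fun j i => f (Matrix.single i j 1), fun N => ?_⟩
  conv_lhs => rw [Matrix.matrix_eq_sum_single N]
  simp only [map_sum, Matrix.trace, Matrix.diag, Matrix.mul_apply, Matrix.of_apply]
  refine Finset.sum_congr rfl fun i _ => Finset.sum_congr rfl fun j _ => ?_
  rw [← smul_eq_mul, ← map_smul, Matrix.smul_single, smul_eq_mul, mul_one]

theorem trace_vecMulVec_mul (x y : ι → ℝ) (Z : Matrix ι ι ℝ) :
    (Matrix.vecMulVec x y * Z).trace = y ⬝ᵥ Z *ᵥ x := by
  rw [Matrix.vecMulVec_mul, Matrix.trace_vecMulVec, Matrix.dotProduct_mulVec, dotProduct_comm]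

/-- Theorem of the alternative for the matrix inequality `Θ + Eᵀ P F + Fᵀ P E < 0` in a symmetric
matrix `P`: if it has no solution, then a hyperplane separates its left-hand sides from the
negative definite matrices, and its normal is a nonzero positive semidefinite multiplier `Z`. -/
theorem exists_dual_of_not_exists [DecidableEq ι] (Θ : Matrix ι ι ℝ) (hΘ : Θ.IsSymm)
    (E F : Matrix ν ι ℝ)
    (h : ¬ ∃ P : Matrix ν ν ℝ, P.IsSymm ∧ (-(Θ + (Eᵀ * P * F + Fᵀ * P * E))).PosDef) :
    ∃ Z : Matrix ι ι ℝ, Z.PosSemidef ∧ Z ≠ 0 ∧ F * Z * Eᵀ + E * Z * Fᵀ = 0 ∧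
      0 ≤ (Θ * Z).trace := by
  classical
  let s : Set (Matrix ι ι ℝ) := {N | ∀ x : ι → ℝ, x ≠ 0 → 0 < x ⬝ᵥ (-N) *ᵥ x}
  -- `t` consists of symmetric matrices only, while `s` is open among all matrices.
  let t : Set (Matrix ι ι ℝ) :=
    {N | ∃ P : Matrix ν ν ℝ, P.IsSymm ∧ N = Θ + (Eᵀ * P * F + Fᵀ * P * E)}
  have hs_open : IsOpen s := isOpen_setOf_quadratic_pos.preimage continuous_neg
  have hs_conv : Convex ℝ s := by
    refine convex_iff_forall_pos.2 fun N hN N' hN' a b ha hb _ x hx => ?_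
    have := add_pos (mul_pos ha (hN x hx)) (mul_pos hb (hN' x hx))
    simp only [Matrix.neg_mulVec, dotProduct_neg, Matrix.add_mulVec, dotProduct_add,
      Matrix.smul_mulVec, dotProduct_smul, smul_eq_mul] at this ⊢
    linarith
  have ht_conv : Convex ℝ t := by
    rintro _ ⟨P, hP, rfl⟩ _ ⟨P', hP', rfl⟩ a b _ _ hab
    refine ⟨a • P + b • P', (hP.smul a).add (hP'.smul b), ?_⟩
    have hb : b = 1 - a := by linarith
    subst hb
    simp only [Matrix.mul_add, Matrix.add_mul, Matrix.mul_smul, Matrix.smul_mul, smul_add,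
      sub_smul, one_smul, Matrix.mul_sub, Matrix.sub_mul]
    abel
  have ht_symm' : ∀ P : Matrix ν ν ℝ, P.IsSymm →
      (Eᵀ * P * F + Fᵀ * P * E)ᵀ = Eᵀ * P * F + Fᵀ * P * E := by
    intro P hP
    simp only [Matrix.transpose_add, Matrix.transpose_mul, Matrix.transpose_transpose, hP.eq,
      Matrix.mul_assoc]
    abel
  have ht_symm : ∀ N ∈ t, Nᵀ = N := by
    rintro _ ⟨P, hP, rfl⟩
    rw [Matrix.transpose_add, ht_symm' P hP, hΘ.eq]
  have hdisj : Disjoint s t := by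
    rw [Set.disjoint_left]
    rintro N hN hNt
    have hsym := ht_symm N hNt
    obtain ⟨P, hP, rfl⟩ := hNt
    refine h ⟨P, hP, .of_dotProduct_mulVec_pos ?_ fun {x} hx => by simpa using hN x hx⟩
    rw [Matrix.IsHermitian, Matrix.conjTranspose_eq_transpose_of_trivial, Matrix.transpose_neg,
      hsym]
  obtain ⟨f, u, hfs, hft⟩ := geometric_hahn_banach_open hs_conv hs_open ht_conv hdisj
  obtain ⟨Z₀, hZ₀⟩ := exists_trace_mul_eq (f : Matrix ι ι ℝ →ₗ[ℝ] ℝ)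
  have hs_mem : ∀ (c : ℝ) (x : ι → ℝ) (ε : ℝ), 0 ≤ c → 0 < ε →
      -(c • Matrix.vecMulVec x x + ε • (1 : Matrix ι ι ℝ)) ∈ s := by
    intro c x ε hc hε y hy
    rw [neg_neg, Matrix.add_mulVec, dotProduct_add, Matrix.smul_mulVec, Matrix.smul_mulVec,
      dotProduct_smul, dotProduct_smul, Matrix.one_mulVec, Matrix.vecMulVec_mulVec,
      dotProduct_smul]
    have h1 : 0 < y ⬝ᵥ y := by
      simpa using (Matrix.PosDef.one (n := ι) (R := ℝ)).dotProduct_mulVec_pos hy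
    have h2 : MulOpposite.op (x ⬝ᵥ y) • (y ⬝ᵥ x) = (x ⬝ᵥ y) * (x ⬝ᵥ y) := by
      rw [dotProduct_comm y x]; rfl
    rw [h2, smul_eq_mul, smul_eq_mul]
    exact add_pos_of_nonneg_of_pos (mul_nonneg hc (mul_self_nonneg _)) (mul_pos hε h1)
  have hf_s : ∀ (c : ℝ) (x : ι → ℝ) (ε : ℝ), 0 ≤ c → 0 < ε →
      -(c * f (Matrix.vecMulVec x x) + ε * f 1) < u := by
    intro c x ε hc hε
    simpa using hfs _ (hs_mem c x ε hc hε)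
  have hu0 : 0 ≤ u := by
    by_contra! hu
    have h1 := hf_s 0 0 1 le_rfl one_pos
    have ha : 0 < f 1 := by linarith
    have h2 := hf_s 0 0 (-u / f 1) le_rfl (div_pos (by linarith) ha)
    rw [div_mul_cancel₀ _ ha.ne'] at h2
    linarith
  have hf_nonneg : ∀ x : ι → ℝ, 0 ≤ f (Matrix.vecMulVec x x) := by
    intro x
    by_contra! hd
    have h1 := hf_s ((|f 1| + |u|) / -f (Matrix.vecMulVec x x)) x 1
      (div_nonneg (by positivity) (by linarith)) one_pos
    have h2 : (|f 1| + |u|) / -f (Matrix.vecMulVec x x) * f (Matrix.vecMulVec x x) =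
        -(|f 1| + |u|) := by
      have := hd.ne
      field_simp
    rw [h2] at h1
    linarith [le_abs_self (f 1), le_abs_self u]
  have hfΘ : u ≤ f Θ := hft Θ ⟨0, Matrix.isSymm_zero, by simp⟩
  have hf_t : ∀ P : Matrix ν ν ℝ, P.IsSymm → f (Eᵀ * P * F + Fᵀ * P * E) = 0 := by
    intro P hP
    have h1 : ∀ c : ℝ, u ≤ f Θ + c * f (Eᵀ * P * F + Fᵀ * P * E) := fun c => by
      have := hft _ ⟨c • P, hP.smul c, rfl⟩
      simpa [← smul_add] using this
    by_contra hg
    have h2 := h1 ((u - f Θ - 1) / f (Eᵀ * P * F + Fᵀ * P * E))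
    rw [div_mul_cancel₀ _ hg] at h2
    linarith
  have htr : ∀ N : Matrix ι ι ℝ, (N * (Z₀ + Z₀ᵀ)).trace = f N + f Nᵀ := by
    intro N
    have h1 : (N * Z₀ᵀ).trace = f Nᵀ := by
      rw [← Matrix.trace_transpose, Matrix.transpose_mul, Matrix.transpose_transpose,
        Matrix.trace_mul_comm]
      exact (hZ₀ Nᵀ).symm
    rw [Matrix.mul_add, Matrix.trace_add, h1]
    exact congrArg (· + f Nᵀ) (hZ₀ N).symm
  have hZsymm : (Z₀ + Z₀ᵀ)ᵀ = Z₀ + Z₀ᵀ := by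
    rw [Matrix.transpose_add, Matrix.transpose_transpose, add_comm]
  -- On symmetric matrices the trace pairing with `Z₀ + Z₀ᵀ` is `2 f`.
  refine ⟨Z₀ + Z₀ᵀ, .of_dotProduct_mulVec_nonneg ?_ fun x => ?_, fun h0 => ?_, ?_, ?_⟩
  · rwa [Matrix.IsHermitian, Matrix.conjTranspose_eq_transpose_of_trivial]
  · rw [star_trivial, ← trace_vecMulVec_mul, htr, Matrix.transpose_vecMulVec]
    exact add_nonneg (hf_nonneg x) (hf_nonneg x)
  · have h1 := htr 1
    have h2 := htr Θ
    have h3 := hf_s 0 0 1 le_rfl one_pos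
    rw [h0, Matrix.mul_zero, Matrix.trace_zero, Matrix.transpose_one] at h1
    rw [h0, Matrix.mul_zero, Matrix.trace_zero, hΘ.eq] at h2
    linarith
  · set Z := Z₀ + Z₀ᵀ with hZ
    set R := F * Z * Eᵀ + E * Z * Fᵀ with hR
    have hRs : R.IsSymm := by
      simp only [Matrix.IsSymm, hR, Matrix.transpose_add, Matrix.transpose_mul,
        Matrix.transpose_transpose, hZsymm, Matrix.mul_assoc]
      abel
    -- `f` vanishes on all directions `Eᵀ P F + Fᵀ P E`; the choice `P = R` gives `tr (R Rᵀ) = 0`.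
    have h1 : (R * Rᴴ).trace = 0 := by
      have h2 := htr (Eᵀ * R * F + Fᵀ * R * E)
      rw [ht_symm' R hRs, hf_t R hRs, add_zero] at h2
      have h3 : ∀ Q, ((F * Z * Eᵀ + E * Z * Fᵀ) * Q).trace =
          ((Eᵀ * Q * F + Fᵀ * Q * E) * Z).trace := fun Q => by
        rw [Matrix.add_mul, Matrix.trace_add, Matrix.add_mul, Matrix.trace_add]
        congr 1
        · simpa only [Matrix.mul_assoc] using Matrix.trace_mul_comm (F * Z) (Eᵀ * Q)
        · simpa only [Matrix.mul_assoc] using Matrix.trace_mul_comm (E * Z) (Fᵀ * Q)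
      rw [Matrix.conjTranspose_eq_transpose_of_trivial, hRs.eq]
      exact (h3 R).trans h2
    exact Matrix.trace_mul_conjTranspose_self_eq_zero_iff.1 h1
  · rw [htr, hΘ.eq]
    linarith

/-- Strict Kalman–Yakubovich–Popov lemma, for a pencil `F - i ω E` of arbitrary real matrices: if
`Θ` is negative on every nonzero complex vector `z` with `F z = i ω E z` for some real `ω`, or with
`E z = 0` (frequency `∞`), then `Θ + Eᵀ P F + Fᵀ P E < 0` has a symmetric solution `P`. No
controllability is needed for the strict inequality. -/
theorem exists_isSymm_posDef_of_frequency [DecidableEq ι] (Θ : Matrix ι ι ℝ) (hΘ : Θ.IsSymm)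
    (E F : Matrix ν ι ℝ)
    (h : ∀ z : ι → ℂ, z ≠ 0 →
      (E.map Complex.ofReal *ᵥ z = 0 ∨ ∃ ω : ℝ, F.map Complex.ofReal *ᵥ z =
        (Complex.I * (ω : ℂ)) • E.map Complex.ofReal *ᵥ z) →
      (star z ⬝ᵥ Θ.map Complex.ofReal *ᵥ z).re < 0) :
    ∃ P : Matrix ν ν ℝ, P.IsSymm ∧ (-(Θ + (Eᵀ * P * F + Fᵀ * P * E))).PosDef := by
  by_contra hcon
  obtain ⟨Z, hZ, hZ0, hEF, htr⟩ := exists_dual_of_not_exists Θ hΘ E F hcon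
  obtain ⟨m, v, hv⟩ := Matrix.posSemidef_iff_eq_sum_vecMulVec.1 hZ
  let S : Matrix ι (Fin m) ℝ := Matrix.of fun i j => v j i
  have hS : S * Sᵀ = Z := by
    rw [hv]
    ext i j
    simp [S, Matrix.mul_apply, Matrix.sum_apply, Matrix.vecMulVec_apply]
  have hmap : ∀ M N : Matrix ν ι ℝ,
      (M.map Complex.ofReal * S.map Complex.ofReal) *
        (N.map Complex.ofReal * S.map Complex.ofReal)ᴴ = (M * Z * Nᵀ).map Complex.ofReal := by
    intro M N
    rw [← map_ofReal_mul, ← map_ofReal_mul, map_ofReal_conjTranspose, ← map_ofReal_mul, ← hS,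
      Matrix.transpose_mul]
    simp only [Matrix.mul_assoc]
  have hEF' : (F.map Complex.ofReal * S.map Complex.ofReal) *
      (E.map Complex.ofReal * S.map Complex.ofReal)ᴴ +
      (E.map Complex.ofReal * S.map Complex.ofReal) *
      (F.map Complex.ofReal * S.map Complex.ofReal)ᴴ = 0 := by
    rw [hmap, hmap, ← Matrix.map_add _ Complex.ofReal_add, hEF, Matrix.map_zero _ Complex.ofReal_zero]
  obtain ⟨b, hb⟩ := exists_orthonormalBasis_frequency (E.map Complex.ofReal * S.map Complex.ofReal)
    (F.map Complex.ofReal * S.map Complex.ofReal) hEF'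
  have hsum := sum_dotProduct_mulVec_eq_trace b (S.map Complex.ofReal) (Θ.map Complex.ofReal)
  -- The sum of the values of `Θ` over the frequency vectors is `tr (Θ Z) ≥ 0`, while each nonzero
  -- one contributes a negative amount; so all of them vanish, and with them `Z`.
  have hre : ∑ i, (star (S.map Complex.ofReal *ᵥ (b i).ofLp) ⬝ᵥ
      Θ.map Complex.ofReal *ᵥ (S.map Complex.ofReal *ᵥ (b i).ofLp)).re = (Θ * Z).trace := by
    rw [← Complex.re_sum, hsum, map_ofReal_conjTranspose, ← map_ofReal_mul, ← map_ofReal_mul, hS,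
      trace_map_ofReal, Complex.ofReal_re]
  have hneg : ∀ i, S.map Complex.ofReal *ᵥ (b i).ofLp ≠ 0 →
      (star (S.map Complex.ofReal *ᵥ (b i).ofLp) ⬝ᵥ
        Θ.map Complex.ofReal *ᵥ (S.map Complex.ofReal *ᵥ (b i).ofLp)).re < 0 := by
    intro i hi
    refine h _ hi ?_
    simpa only [Matrix.mulVec_mulVec] using hb i
  have hzero : ∀ i, S.map Complex.ofReal *ᵥ (b i).ofLp = 0 := by
    by_contra! hne
    obtain ⟨i, hi⟩ := hne
    have : ∑ i, (star (S.map Complex.ofReal *ᵥ (b i).ofLp) ⬝ᵥ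
        Θ.map Complex.ofReal *ᵥ (S.map Complex.ofReal *ᵥ (b i).ofLp)).re < ∑ _i : Fin (Module.finrank ℂ (EuclideanSpace ℂ (Fin m))), (0 : ℝ) := by
      refine Finset.sum_lt_sum (fun j _ => ?_) ⟨i, Finset.mem_univ i, hneg i hi⟩
      by_cases hj : S.map Complex.ofReal *ᵥ (b j).ofLp = 0
      · simp [hj]
      · exact (hneg j hj).le
    rw [hre, Finset.sum_const_zero] at this
    exact absurd htr (not_le.2 this)
  have hS0 : S.map Complex.ofReal = 0 := by
    have := sum_dotProduct_mulVec_eq_trace b (S.map Complex.ofReal) 1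
    simp only [hzero, star_zero, zero_dotProduct, Finset.sum_const_zero, Matrix.one_mul] at this
    exact Matrix.trace_mul_conjTranspose_self_eq_zero_iff.1 this.symm
  apply hZ0
  have : S = 0 := by
    ext i j
    simpa using congr_fun (congr_fun hS0 i) j
  rw [← hS, this, Matrix.zero_mul]

end KYP

/-! ### Lyapunov inequality -/

section Lyapunov

variable {ν : Type*} [Fintype ν] [DecidableEq ν]

theorem mem_spectrum_iff_exists_mulVec {N : Matrix ν ν ℂ} {z : ℂ} :
    z ∈ spectrum ℂ N ↔ ∃ v, v ≠ 0 ∧ N *ᵥ v = z • v := by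
  rw [spectrum.mem_iff, Matrix.isUnit_iff_isUnit_det, isUnit_iff_ne_zero, not_not,
    ← Matrix.exists_mulVec_eq_zero_iff]
  refine exists_congr fun v => and_congr_right fun _ => ?_
  rw [Matrix.sub_mulVec, Algebra.algebraMap_eq_smul_one, Matrix.smul_mulVec, Matrix.one_mulVec,
    sub_eq_zero, eq_comm]

theorem tendsto_pow_zero_of_spectralRadius_lt_one {R : Type*} [NormedRing R] [NormedAlgebra ℂ R]
    [CompleteSpace R] {a : R} (ha : spectralRadius ℂ a < 1) :
    Tendsto (fun k : ℕ => a ^ k) atTop (𝓝 0) := by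
  obtain ⟨r, hr, hr1⟩ := exists_between ha
  lift r to NNReal using (hr1.trans ENNReal.one_lt_top).ne
  have h1 := (spectrum.pow_nnnorm_pow_one_div_tendsto_nhds_spectralRadius a).eventually
    (gt_mem_nhds hr)
  have h2 : Tendsto (fun k : ℕ => (r : ℝ) ^ k) atTop (𝓝 0) :=
    tendsto_pow_atTop_nhds_zero_of_lt_one r.2 (by exact_mod_cast hr1)
  refine squeeze_zero_norm' ?_ h2
  filter_upwards [h1, eventually_gt_atTop 0] with k hk hk0
  have hk' : (k : ℝ) ≠ 0 := by exact_mod_cast hk0.ne'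
  have h3 := ENNReal.rpow_le_rpow hk.le (Nat.cast_nonneg k : (0 : ℝ) ≤ k)
  rw [← ENNReal.rpow_mul, one_div, inv_mul_cancel₀ hk', ENNReal.rpow_one,
    ENNReal.rpow_natCast] at h3
  exact_mod_cast h3

theorem tendsto_pow_zero_of_forall_spectrum {N : Matrix ν ν ℂ}
    (h : ∀ z ∈ spectrum ℂ N, ‖z‖ < 1) : Tendsto (fun k : ℕ => N ^ k) atTop (𝓝 0) := by
  cases isEmpty_or_nonempty ν
  · exact tendsto_const_nhds.congr fun k => Subsingleton.elim _ _
  · let _ : NormedRing (Matrix ν ν ℂ) := Matrix.linftyOpNormedRing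
    let _ : NormedAlgebra ℂ (Matrix ν ν ℂ) := Matrix.linftyOpNormedAlgebra
    have : CompleteSpace (Matrix ν ν ℂ) := FiniteDimensional.complete ℂ _
    exact tendsto_pow_zero_of_spectralRadius_lt_one
      (spectrum.spectralRadius_lt_of_forall_lt N (r := 1) fun z hz => h z hz)

/-- For a stable `M`, each Hermitian solution of `Mᴴ P + P M < 0` is positive definite. The Cayley
transform `N = (1 + M) (1 - M)⁻¹` has spectral radius less than `1` and turns the inequality into
`Nᴴ P N < P`, so the form of `P` decreases strictly along `x, N x, N² x, …`, which tends to `0`. -/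
theorem posDef_of_lyapunov {M P : Matrix ν ν ℂ} (hM : ∀ z ∈ spectrum ℂ M, z.re < 0)
    (hP : P.IsHermitian) (h : (-(Mᴴ * P + P * M)).PosDef) : P.PosDef := by
  have hDu : IsUnit (1 - M).det := by
    rw [← Matrix.isUnit_iff_isUnit_det]
    by_contra hn
    have := hM 1 (by rwa [spectrum.mem_iff, map_one])
    simp at this
    linarith
  set N : Matrix ν ν ℂ := (1 + M) * (1 - M)⁻¹ with hN
  have hDv : ∀ x : ν → ℂ, (1 - M) *ᵥ ((1 - M)⁻¹ *ᵥ x) = x := fun x => by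
    rw [Matrix.mulVec_mulVec, Matrix.mul_nonsing_inv _ hDu, Matrix.one_mulVec]
  have hspec : ∀ z ∈ spectrum ℂ N, ‖z‖ < 1 := by
    intro z hz
    obtain ⟨x, hx, hNx⟩ := mem_spectrum_iff_exists_mulVec.1 hz
    set y := (1 - M)⁻¹ *ᵥ x with hy
    have hxy : x = y - M *ᵥ y := by
      rw [← hDv x, Matrix.sub_mulVec, Matrix.one_mulVec]
    have hy0 : y ≠ 0 := fun h0 => hx (by rw [hxy, h0, Matrix.mulVec_zero, sub_zero])
    have h1 : y + M *ᵥ y = z • (y - M *ᵥ y) := by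
      rw [← hxy, ← hNx, hN, ← Matrix.mulVec_mulVec, Matrix.add_mulVec, Matrix.one_mulVec]
    have hz1 : z + 1 ≠ 0 := by
      intro h0
      have hz' : z = -1 := eq_neg_of_add_eq_zero_left h0
      have h2 : (2 : ℂ) • y = 0 := by
        rw [two_smul]
        calc y + y = y + M *ᵥ y - M *ᵥ y + y := by abel
          _ = 0 := by rw [h1, hz', neg_one_smul]; abel
      exact hy0 ((smul_eq_zero.1 h2).resolve_left two_ne_zero)
    have hev : M *ᵥ y = ((z - 1) / (z + 1)) • y := by
      ext j
      have hj := congr_fun h1 j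
      simp only [Pi.add_apply, Pi.sub_apply, Pi.smul_apply, smul_eq_mul] at hj ⊢
      rw [div_mul_eq_mul_div, eq_div_iff hz1]
      linear_combination hj
    have hre := hM _ (mem_spectrum_iff_exists_mulVec.2 ⟨y, hy0, hev⟩)
    rw [Complex.div_re, ← add_div] at hre
    have hnum := neg_of_div_neg_left hre (Complex.normSq_nonneg _)
    have hsq : ‖z‖ ^ 2 < 1 := by
      rw [← Complex.normSq_eq_norm_sq, Complex.normSq_apply]
      simp at hnum
      linarith
    exact (sq_lt_one_iff₀ (norm_nonneg z)).1 hsq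
  -- The Stein inequality `Nᴴ P N < P`, tested on `x = (1 - M) y`.
  have hstein : ∀ x : ν → ℂ, x ≠ 0 →
      (star (N *ᵥ x) ⬝ᵥ P *ᵥ (N *ᵥ x)).re < (star x ⬝ᵥ P *ᵥ x).re := by
    intro x hx
    set y := (1 - M)⁻¹ *ᵥ x with hy
    have hxy : x = (1 - M) *ᵥ y := (hDv x).symm
    have hy0 : y ≠ 0 := fun h0 => hx (by rw [hxy, h0, Matrix.mulVec_zero])
    have hid : (1 - M)ᴴ * P * (1 - M) - (1 + M)ᴴ * P * (1 + M) =
        (2 : ℂ) • -(Mᴴ * P + P * M) := by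
      simp only [Matrix.conjTranspose_sub, Matrix.conjTranspose_add, Matrix.conjTranspose_one,
        two_smul]
      noncomm_ring
    have h1 : star x ⬝ᵥ P *ᵥ x - star (N *ᵥ x) ⬝ᵥ P *ᵥ (N *ᵥ x) =
        2 * (star y ⬝ᵥ (-(Mᴴ * P + P * M)) *ᵥ y) := by
      have hNx : N *ᵥ x = (1 + M) *ᵥ y := by rw [hN, ← Matrix.mulVec_mulVec]
      clear_value y
      rw [hNx]
      conv_lhs => rw [hxy]
      rw [star_mulVec_dotProduct_mulVec, star_mulVec_dotProduct_mulVec, ← dotProduct_sub,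
        ← Matrix.sub_mulVec, hid, Matrix.smul_mulVec, dotProduct_smul, smul_eq_mul]
    have h2 := (Complex.pos_iff.1 (h.dotProduct_mulVec_pos hy0)).1
    have h3 := congrArg Complex.re h1
    rw [Complex.sub_re, Complex.mul_re, Complex.re_ofNat, Complex.im_ofNat, zero_mul,
      sub_zero] at h3
    linarith
  refine .of_dotProduct_mulVec_pos hP fun {x} hx => ?_
  rw [Complex.pos_iff]
  refine ⟨?_, (hP.im_star_dotProduct_mulVec_self x).symm⟩
  set a : ℕ → ℝ := fun k => (star (N ^ k *ᵥ x) ⬝ᵥ P *ᵥ (N ^ k *ᵥ x)).re with ha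
  have hsucc : ∀ k, N ^ (k + 1) *ᵥ x = N *ᵥ (N ^ k *ᵥ x) := fun k => by
    rw [Matrix.mulVec_mulVec, pow_succ']
  have hanti : Antitone a := by
    refine antitone_nat_of_succ_le fun k => ?_
    simp only [ha]
    rw [hsucc]
    by_cases h0 : N ^ k *ᵥ x = 0
    · simp [h0]
    · exact (hstein _ h0).le
  have hlim : Tendsto a atTop (𝓝 0) := by
    let g : Matrix ν ν ℂ → ℝ := fun Q => (star (Q *ᵥ x) ⬝ᵥ P *ᵥ (Q *ᵥ x)).re
    have hc : Continuous g := by fun_prop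
    have h0 : g 0 = 0 := by simp [g]
    have := (hc.tendsto 0).comp (tendsto_pow_zero_of_forall_spectrum hspec)
    rwa [h0] at this
  have h1 : 0 ≤ a 1 := hanti.le_of_tendsto hlim 1
  have h2 := hstein x hx
  have h3 : a 1 = (star (N *ᵥ x) ⬝ᵥ P *ᵥ (N *ᵥ x)).re := by simp only [ha, pow_one]
  linarith

end Lyapunov

/-! ### The bounded real inequality and its quadratic form -/

section BoundedReal

variable {ν δ κ : Type*} [Fintype ν] [DecidableEq δ] [DecidableEq κ]

/-- The matrix of the bounded real inequality in `X`, for the system `x' = M x + B w`, `y = C x`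
without input. -/
def boundedRealMatrix (M : Matrix ν ν ℝ) (B : Matrix ν δ ℝ) (C : Matrix κ ν ℝ) (γ : ℝ)
    (X : Matrix ν ν ℝ) : Matrix ((ν ⊕ δ) ⊕ κ) ((ν ⊕ δ) ⊕ κ) ℝ :=
  Matrix.fromBlocks
    (Matrix.fromBlocks ((M * X)ᵀ + M * X) B Bᵀ (-(γ • (1 : Matrix δ δ ℝ))))
    (Matrix.fromRows (C * X)ᵀ 0) (Matrix.fromCols (C * X) 0) (-(γ • (1 : Matrix κ κ ℝ)))

theorem isSymm_boundedRealMatrix (M : Matrix ν ν ℝ) (B : Matrix ν δ ℝ) (C : Matrix κ ν ℝ) (γ : ℝ)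
    (X : Matrix ν ν ℝ) : (boundedRealMatrix M B C γ X).IsSymm := by
  unfold boundedRealMatrix
  refine Matrix.IsSymm.fromBlocks (Matrix.IsSymm.fromBlocks ?_ rfl ?_) ?_ ?_
  · rw [Matrix.IsSymm, Matrix.transpose_add, Matrix.transpose_transpose, add_comm]
  · exact (Matrix.isSymm_one.smul γ).neg
  · rw [Matrix.transpose_fromRows, Matrix.transpose_transpose, Matrix.transpose_zero]
  · exact (Matrix.isSymm_one.smul γ).neg

variable [Fintype δ] [Fintype κ]

theorem map_neg_smul_one_mulVec {ι : Type*} [Fintype ι] [DecidableEq ι] (γ : ℝ) (v : ι → ℂ) :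
    (-(γ • (1 : Matrix ι ι ℝ))).map Complex.ofReal *ᵥ v = (-(γ : ℂ)) • v := by
  have : (-(γ • (1 : Matrix ι ι ℝ))).map Complex.ofReal = (-(γ : ℂ)) • (1 : Matrix ι ι ℂ) := by
    ext i j
    by_cases h : i = j <;> simp [h]
  rw [this, Matrix.smul_mulVec, Matrix.one_mulVec]

theorem star_sumElim {α β : Type*} (p : α → ℂ) (q : β → ℂ) :
    star (Sum.elim p q) = Sum.elim (star p) (star q) := by
  ext i
  cases i <;> rfl

/-- In the state `x = X u`, the quadratic form of the bounded real matrix involves only the vector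
field `M x + B a` and the output `C x`. -/
theorem re_boundedRealMatrix_form (M : Matrix ν ν ℝ) (B : Matrix ν δ ℝ) (C : Matrix κ ν ℝ) (γ : ℝ)
    (X : Matrix ν ν ℝ) (u : ν → ℂ) (a : δ → ℂ) (b : κ → ℂ) :
    (star (Sum.elim (Sum.elim u a) b) ⬝ᵥ
      (boundedRealMatrix M B C γ X).map Complex.ofReal *ᵥ (Sum.elim (Sum.elim u a) b)).re =
    2 * (star u ⬝ᵥ (M.map Complex.ofReal *ᵥ (X.map Complex.ofReal *ᵥ u) +
        B.map Complex.ofReal *ᵥ a)).re - γ * (star a ⬝ᵥ a).re +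
      2 * (star b ⬝ᵥ C.map Complex.ofReal *ᵥ (X.map Complex.ofReal *ᵥ u)).re -
      γ * (star b ⬝ᵥ b).re := by
  have e1 := re_star_dotProduct_transpose_mulVec (M * X) u u
  have e2 := re_star_dotProduct_transpose_mulVec B a u
  have e3 := re_star_dotProduct_transpose_mulVec (C * X) u b
  have hR : (Matrix.fromRows (C * X)ᵀ (0 : Matrix δ κ ℝ)).map Complex.ofReal *ᵥ b =
      Sum.elim ((C * X)ᵀ.map Complex.ofReal *ᵥ b) 0 := by
    ext i
    cases i <;> simp [Matrix.mulVec, dotProduct]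
  have hC : (Matrix.fromCols (C * X) (0 : Matrix κ δ ℝ)).map Complex.ofReal *ᵥ Sum.elim u a =
      (C * X).map Complex.ofReal *ᵥ u := by
    ext i
    simp [Matrix.mulVec, dotProduct]
  have hadd : ((M * X)ᵀ + M * X).map Complex.ofReal =
      (M * X)ᵀ.map Complex.ofReal + (M * X).map Complex.ofReal :=
    Matrix.map_add _ Complex.ofReal_add _ _
  unfold boundedRealMatrix
  rw [star_sumElim, star_sumElim, Matrix.fromBlocks_map, Matrix.fromBlocks_map,
    Matrix.fromBlocks_mulVec, sumElim_dotProduct_sumElim, Sum.elim_comp_inl, Sum.elim_comp_inr,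
    Matrix.fromBlocks_mulVec, hR, dotProduct_add, sumElim_dotProduct_sumElim,
    sumElim_dotProduct_sumElim, Sum.elim_comp_inl, Sum.elim_comp_inr, hC, hadd,
    map_neg_smul_one_mulVec, map_neg_smul_one_mulVec, Matrix.add_mulVec]
  simp only [dotProduct_add, dotProduct_zero, dotProduct_smul, Complex.add_re, e1, e2, e3,
    smul_eq_mul, ← Complex.ofReal_neg, Complex.re_ofReal_mul, Complex.zero_re]
  rw [map_ofReal_mul, map_ofReal_mul, ← Matrix.mulVec_mulVec, ← Matrix.mulVec_mulVec]
  ring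

end BoundedReal

/-! ### The largest singular value as a gain -/

section Gain

variable {δ κ : Type*} [Fintype δ] [DecidableEq δ] [Fintype κ]

theorem re_star_mulVec_le_sigmaMax_sq (G : Matrix κ δ ℂ) (a : δ → ℂ) :
    (star (G *ᵥ a) ⬝ᵥ G *ᵥ a).re ≤ sigmaMax G ^ 2 * (star a ⬝ᵥ a).re := by
  rw [re_star_dotProduct_self, re_star_dotProduct_self, ← mul_pow]
  have := (LinearMap.toContinuousLinearMap (Matrix.toEuclideanLin G)).le_opNorm (WithLp.toLp 2 a)
  exact pow_le_pow_left₀ (norm_nonneg _) this 2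

theorem sigmaMax_le {G : Matrix κ δ ℂ} {c : ℝ} (hc : 0 ≤ c)
    (h : ∀ a : δ → ℂ, (star (G *ᵥ a) ⬝ᵥ G *ᵥ a).re ≤ c ^ 2 * (star a ⬝ᵥ a).re) :
    sigmaMax G ≤ c := by
  refine ContinuousLinearMap.opNorm_le_bound _ hc fun x => ?_
  have := h x.ofLp
  rw [re_star_dotProduct_self, re_star_dotProduct_self, ← mul_pow] at this
  exact (sq_le_sq₀ (norm_nonneg _) (by positivity)).1 this

theorem sigmaMax_nonneg (G : Matrix κ δ ℂ) : 0 ≤ sigmaMax G := norm_nonneg _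

end Gain

/-! ### The bounded real lemma -/

section BoundedReal

variable {ν δ κ : Type*} [Fintype ν] [DecidableEq ν] [Fintype δ] [DecidableEq δ] [Fintype κ]
  [DecidableEq κ]

/-- The transfer matrix `C (s 1 - M)⁻¹ B` of `x' = M x + B w`, `y = C x`; it has its meaning only
where `s` is not an eigenvalue of `M`, the inverse being `0` elsewhere. -/
noncomputable def transferMatrix (M : Matrix ν ν ℝ) (B : Matrix ν δ ℝ) (C : Matrix κ ν ℝ) (s : ℂ) :
    Matrix κ δ ℂ :=
  C.map Complex.ofReal * (s • (1 : Matrix ν ν ℂ) - M.map Complex.ofReal)⁻¹ * B.map Complex.ofReal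

theorem IsHurwitz.isUnit_det {M : Matrix ν ν ℝ} (hM : IsHurwitz M) (ω : ℝ) :
    IsUnit ((Complex.I * (ω : ℂ)) • (1 : Matrix ν ν ℂ) - M.map Complex.ofReal).det := by
  rw [← Matrix.isUnit_iff_isUnit_det]
  by_contra hn
  have := hM (Complex.I * ω) (by rwa [spectrum.mem_iff, Algebra.algebraMap_eq_smul_one])
  simp at this

theorem exists_re_boundedRealMatrix_form_le {M : Matrix ν ν ℝ} {B : Matrix ν δ ℝ}
    {C : Matrix κ ν ℝ} {γ : ℝ} {X : Matrix ν ν ℝ}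
    (h : (-(boundedRealMatrix M B C γ X)).PosDef) :
    ∃ ε : ℝ, 0 < ε ∧ ∀ u a b,
      2 * (star u ⬝ᵥ (M.map Complex.ofReal *ᵥ (X.map Complex.ofReal *ᵥ u) +
        B.map Complex.ofReal *ᵥ a)).re - γ * (star a ⬝ᵥ a).re +
      2 * (star b ⬝ᵥ C.map Complex.ofReal *ᵥ (X.map Complex.ofReal *ᵥ u)).re -
      γ * (star b ⬝ᵥ b).re +
      ε * ((star u ⬝ᵥ u).re + (star a ⬝ᵥ a).re + (star b ⬝ᵥ b).re) ≤ 0 := by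
  obtain ⟨ε, hε, hpos⟩ := h.exists_sub_smul_one
  refine ⟨ε, hε, fun u a b => ?_⟩
  have h1 := (posDef_map_ofReal_iff.2 hpos).posSemidef.dotProduct_mulVec_nonneg
    (Sum.elim (Sum.elim u a) b)
  have h2 : (-(boundedRealMatrix M B C γ X) - ε • 1).map Complex.ofReal =
      -(boundedRealMatrix M B C γ X).map Complex.ofReal + (-(ε • 1 : Matrix _ _ ℝ)).map
        Complex.ofReal := by
    ext i j
    simp [sub_eq_add_neg]
  have h3 := (Complex.nonneg_iff.1 h1).1
  rw [h2, Matrix.add_mulVec, Matrix.neg_mulVec, dotProduct_add, dotProduct_neg, Complex.add_re,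
    Complex.neg_re, re_boundedRealMatrix_form, map_neg_smul_one_mulVec, dotProduct_smul,
    star_sumElim, star_sumElim, sumElim_dotProduct_sumElim, sumElim_dotProduct_sumElim, smul_eq_mul,
    ← Complex.ofReal_neg, Complex.re_ofReal_mul, Complex.add_re, Complex.add_re] at h3
  linarith

theorem isHurwitz_of_boundedRealMatrix {M : Matrix ν ν ℝ} {B : Matrix ν δ ℝ}
    {C : Matrix κ ν ℝ} {γ : ℝ} {X : Matrix ν ν ℝ} (hX : X.PosDef)
    (h : (-(boundedRealMatrix M B C γ X)).PosDef) : IsHurwitz M := by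
  obtain ⟨ε, hε, hform⟩ := exists_re_boundedRealMatrix_form_le h
  have hXc := posDef_map_ofReal_iff.2 hX
  intro z hz
  obtain ⟨x, hx, hMx⟩ := mem_spectrum_iff_exists_mulVec.1 hz
  obtain ⟨u, rfl⟩ := Matrix.mulVec_surjective_iff_isUnit.2 hXc.isUnit x
  have hu : u ≠ 0 := fun h0 => hx (by rw [h0, Matrix.mulVec_zero])
  have h1 := hform u 0 0
  obtain ⟨hre, him⟩ := Complex.pos_iff.1 (hXc.dotProduct_mulVec_pos hu)
  rw [hMx] at h1
  simp only [Matrix.mulVec_zero, add_zero, dotProduct_smul, smul_eq_mul, star_zero,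
    zero_dotProduct, Complex.mul_re, ← him, Complex.zero_re, mul_zero, sub_zero] at h1
  have h2 := mul_pos hε (re_star_dotProduct_self_pos hu)
  by_contra! hz0
  have h3 := mul_nonneg hz0 hre.le
  linarith

/-- The bound `c < γ` is uniform in the frequency, as a strict inequality for the supremum
requires; it comes from the margin `ε` in the strict matrix inequality. -/
theorem exists_sigmaMax_le_of_boundedRealMatrix {M : Matrix ν ν ℝ} {B : Matrix ν δ ℝ}
    {C : Matrix κ ν ℝ} {γ : ℝ} (hγ : 0 < γ) {X : Matrix ν ν ℝ} (hX : X.PosDef)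
    (h : (-(boundedRealMatrix M B C γ X)).PosDef) :
    ∃ c : ℝ, c < γ ∧ ∀ ω : ℝ, sigmaMax (transferMatrix M B C (Complex.I * (ω : ℂ))) ≤ c := by
  have hM := isHurwitz_of_boundedRealMatrix hX h
  obtain ⟨ε, hε, hform⟩ := exists_re_boundedRealMatrix_form_le h
  have hXc := posDef_map_ofReal_iff.2 hX
  refine ⟨√(γ * (γ - ε)), ?_, fun ω => sigmaMax_le (Real.sqrt_nonneg _) fun a => ?_⟩
  · rw [Real.sqrt_lt' hγ]
    nlinarith [mul_pos hγ hε]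
  set R := (Complex.I * (ω : ℂ)) • (1 : Matrix ν ν ℂ) - M.map Complex.ofReal with hR
  obtain ⟨u, hu⟩ := Matrix.mulVec_surjective_iff_isUnit.2 hXc.isUnit
    (R⁻¹ *ᵥ (B.map Complex.ofReal *ᵥ a))
  have hy : transferMatrix M B C (Complex.I * (ω : ℂ)) *ᵥ a =
      C.map Complex.ofReal *ᵥ (X.map Complex.ofReal *ᵥ u) := by
    rw [hu, transferMatrix, ← hR, ← Matrix.mulVec_mulVec, ← Matrix.mulVec_mulVec]
  have hstate : M.map Complex.ofReal *ᵥ (X.map Complex.ofReal *ᵥ u) +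
      B.map Complex.ofReal *ᵥ a = (Complex.I * (ω : ℂ)) • X.map Complex.ofReal *ᵥ u := by
    have h1 : R *ᵥ (X.map Complex.ofReal *ᵥ u) = B.map Complex.ofReal *ᵥ a := by
      rw [hu, Matrix.mulVec_mulVec, Matrix.mul_nonsing_inv _ (hM.isUnit_det ω), Matrix.one_mulVec]
    rw [← h1, hR, Matrix.sub_mulVec, Matrix.smul_mulVec, Matrix.one_mulVec]
    abel
  rw [hy]
  set y := C.map Complex.ofReal *ᵥ (X.map Complex.ofReal *ᵥ u) with hydef
  -- The choice `b = γ⁻¹ y` maximizes the part of the form that depends on `b`.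
  have h1 := hform u a ((γ⁻¹ : ℝ) • y)
  have him := (Complex.nonneg_iff.1 (hXc.posSemidef.dotProduct_mulVec_nonneg u)).2
  have hz : (star u ⬝ᵥ (Complex.I * (ω : ℂ)) • X.map Complex.ofReal *ᵥ u).re = 0 := by
    rw [dotProduct_smul, smul_eq_mul, Complex.mul_re, ← him]
    simp
  have hb : star ((γ⁻¹ : ℝ) • y) = (γ⁻¹ : ℝ) • star y := by simp
  rw [hstate, hz, ← hydef, hb, smul_dotProduct, smul_dotProduct, dotProduct_smul] at h1
  simp only [Complex.real_smul, Complex.re_ofReal_mul] at h1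
  have hyy := re_star_dotProduct_self_nonneg y
  have huu := re_star_dotProduct_self_nonneg u
  have haa := re_star_dotProduct_self_nonneg a
  have e1 : γ * (γ⁻¹ * (γ⁻¹ * (star y ⬝ᵥ y).re)) = γ⁻¹ * (star y ⬝ᵥ y).re := by
    field_simp
  have hb0 : 0 ≤ ε * (γ⁻¹ * (γ⁻¹ * (star y ⬝ᵥ y).re)) := by positivity
  have hu0 : 0 ≤ ε * (star u ⬝ᵥ u).re := by positivity
  have h2 : γ⁻¹ * (star y ⬝ᵥ y).re ≤ (γ - ε) * (star a ⬝ᵥ a).re := by linarith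
  have h3 : (star y ⬝ᵥ y).re ≤ γ * (γ - ε) * (star a ⬝ᵥ a).re := by
    rw [inv_mul_le_iff₀ hγ] at h2
    linarith
  refine h3.trans (mul_le_mul_of_nonneg_right ?_ haa)
  rw [Real.sq_sqrt']
  exact le_max_left _ _

/-- The hard half of the bounded real lemma. The frequency `∞` needs no hypothesis, since there is
no direct feedthrough from disturbance to output. -/
theorem exists_boundedRealMatrix_of_sigmaMax_lt {M : Matrix ν ν ℝ} {B : Matrix ν δ ℝ}
    {C : Matrix κ ν ℝ} {γ : ℝ} (hγ : 0 < γ) (hM : IsHurwitz M)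
    (h : ∀ ω : ℝ, sigmaMax (transferMatrix M B C (Complex.I * (ω : ℂ))) < γ) :
    ∃ X : Matrix ν ν ℝ, X.PosDef ∧ (-(boundedRealMatrix M B C γ X)).PosDef := by
  set Θ : Matrix (ν ⊕ δ) (ν ⊕ δ) ℝ :=
    Matrix.fromBlocks (γ⁻¹ • (Cᵀ * C)) 0 0 (-(γ • (1 : Matrix δ δ ℝ))) with hΘdef
  set E : Matrix ν (ν ⊕ δ) ℝ := Matrix.fromCols 1 0 with hE
  set F : Matrix ν (ν ⊕ δ) ℝ := Matrix.fromCols M B with hF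
  have hEz : ∀ (x : ν → ℂ) (a : δ → ℂ), E.map Complex.ofReal *ᵥ Sum.elim x a = x := fun x a => by
    rw [hE, Matrix.fromCols_map, Matrix.fromCols_mulVec_sumElim,
      Matrix.map_one _ Complex.ofReal_zero Complex.ofReal_one,
      Matrix.map_zero _ Complex.ofReal_zero, Matrix.one_mulVec, Matrix.zero_mulVec, add_zero]
  have hFz : ∀ (x : ν → ℂ) (a : δ → ℂ), F.map Complex.ofReal *ᵥ Sum.elim x a =
      M.map Complex.ofReal *ᵥ x + B.map Complex.ofReal *ᵥ a := fun x a => by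
    rw [hF, Matrix.fromCols_map, Matrix.fromCols_mulVec_sumElim]
  have hΘz : ∀ (x : ν → ℂ) (a : δ → ℂ),
      (star (Sum.elim x a) ⬝ᵥ Θ.map Complex.ofReal *ᵥ Sum.elim x a).re =
      γ⁻¹ * (star (C.map Complex.ofReal *ᵥ x) ⬝ᵥ C.map Complex.ofReal *ᵥ x).re -
        γ * (star a ⬝ᵥ a).re := fun x a => by
    have h1 : (γ⁻¹ • (Cᵀ * C)).map Complex.ofReal =
        ((γ⁻¹ : ℝ) : ℂ) • (C.map Complex.ofReal)ᴴ * C.map Complex.ofReal := by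
      rw [map_ofReal_conjTranspose, Matrix.smul_mul, ← map_ofReal_mul]
      ext i j
      simp
    rw [hΘdef, Matrix.fromBlocks_map, Matrix.fromBlocks_mulVec, star_sumElim,
      sumElim_dotProduct_sumElim, Sum.elim_comp_inl, Sum.elim_comp_inr, map_neg_smul_one_mulVec, h1,
      Matrix.map_zero _ Complex.ofReal_zero, Matrix.map_zero _ Complex.ofReal_zero,
      Matrix.zero_mulVec, Matrix.zero_mulVec, add_zero, zero_add, Matrix.smul_mul,
      Matrix.smul_mulVec, dotProduct_smul, dotProduct_smul, ← Matrix.mulVec_mulVec,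
      Matrix.dotProduct_mulVec (star x), ← Matrix.star_mulVec, smul_eq_mul, smul_eq_mul,
      ← Complex.ofReal_neg, Complex.add_re, Complex.re_ofReal_mul, Complex.re_ofReal_mul]
    ring
  have hΘ : Θ.IsSymm := by
    refine Matrix.IsSymm.fromBlocks ?_ (by simp) (Matrix.isSymm_one.smul γ).neg
    rw [Matrix.IsSymm, Matrix.transpose_smul, Matrix.transpose_mul, Matrix.transpose_transpose]
  obtain ⟨P, hP, hPdef⟩ := exists_isSymm_posDef_of_frequency Θ hΘ E F (by
    intro z hz hfreq
    obtain ⟨x, a, rfl⟩ : ∃ x a, z = Sum.elim x a := ⟨_, _, (Sum.elim_comp_inl_inr z).symm⟩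
    rw [hEz, hFz] at hfreq
    rw [hΘz]
    rcases hfreq with rfl | ⟨ω, hω⟩
    · have ha : a ≠ 0 := by
        rintro rfl
        exact hz (by ext i; cases i <;> rfl)
      have := mul_pos hγ (re_star_dotProduct_self_pos ha)
      simp only [Matrix.mulVec_zero, star_zero, zero_dotProduct, Complex.zero_re, mul_zero]
      linarith
    · set R := (Complex.I * (ω : ℂ)) • (1 : Matrix ν ν ℂ) - M.map Complex.ofReal with hR
      have hRx : R *ᵥ x = B.map Complex.ofReal *ᵥ a := by
        rw [hR, Matrix.sub_mulVec, Matrix.smul_mulVec, Matrix.one_mulVec, ← hω]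
        abel
      have hx : x = R⁻¹ *ᵥ (B.map Complex.ofReal *ᵥ a) := by
        rw [← hRx, Matrix.mulVec_mulVec, Matrix.nonsing_inv_mul _ (hM.isUnit_det ω),
          Matrix.one_mulVec]
      have ha : a ≠ 0 := by
        rintro rfl
        rw [Matrix.mulVec_zero, Matrix.mulVec_zero] at hx
        subst hx
        exact hz (by ext i; cases i <;> rfl)
      have hy : transferMatrix M B C (Complex.I * (ω : ℂ)) *ᵥ a = C.map Complex.ofReal *ᵥ x := by
        rw [hx, transferMatrix, ← hR, ← Matrix.mulVec_mulVec, ← Matrix.mulVec_mulVec]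
      have h1 := re_star_mulVec_le_sigmaMax_sq (transferMatrix M B C (Complex.I * (ω : ℂ))) a
      rw [hy] at h1
      have haa := re_star_dotProduct_self_pos ha
      have h2 : sigmaMax (transferMatrix M B C (Complex.I * (ω : ℂ))) ^ 2 < γ ^ 2 :=
        pow_lt_pow_left₀ (h ω) (sigmaMax_nonneg _) two_ne_zero
      have h3 := h1.trans_lt (mul_lt_mul_of_pos_right h2 haa)
      have h4 := mul_lt_mul_of_pos_left h3 (inv_pos.2 hγ)
      have h5 : γ⁻¹ * (γ ^ 2 * (star a ⬝ᵥ a).re) = γ * (star a ⬝ᵥ a).re := by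
        field_simp
      linarith)
  have hQz : ∀ (x : ν → ℂ) (a : δ → ℂ), Sum.elim x a ≠ 0 →
      γ⁻¹ * (star (C.map Complex.ofReal *ᵥ x) ⬝ᵥ C.map Complex.ofReal *ᵥ x).re -
        γ * (star a ⬝ᵥ a).re + 2 * (star x ⬝ᵥ P.map Complex.ofReal *ᵥ
          (M.map Complex.ofReal *ᵥ x + B.map Complex.ofReal *ᵥ a)).re < 0 := by
    intro x a hxa
    have h1 := (Complex.pos_iff.1 ((posDef_map_ofReal_iff.2 hPdef).dotProduct_mulVec_pos hxa)).1
    have h2 : (-(Θ + (Eᵀ * P * F + Fᵀ * P * E))).map Complex.ofReal =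
        -(Θ.map Complex.ofReal + ((E.map Complex.ofReal)ᴴ * P.map Complex.ofReal *
          F.map Complex.ofReal + (F.map Complex.ofReal)ᴴ * P.map Complex.ofReal *
          E.map Complex.ofReal)) := by
      rw [map_ofReal_conjTranspose, map_ofReal_conjTranspose, ← map_ofReal_mul, ← map_ofReal_mul,
        ← map_ofReal_mul, ← map_ofReal_mul]
      ext i j
      simp
    have h3 := re_star_dotProduct_transpose_mulVec P x
      (M.map Complex.ofReal *ᵥ x + B.map Complex.ofReal *ᵥ a)
    rw [hP.eq] at h3
    rw [h2, Matrix.neg_mulVec, dotProduct_neg, Complex.neg_re, Matrix.add_mulVec, dotProduct_add,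
      Complex.add_re, hΘz, Matrix.add_mulVec, dotProduct_add, Complex.add_re,
      ← Matrix.mulVec_mulVec, ← Matrix.mulVec_mulVec, ← Matrix.mulVec_mulVec,
      ← Matrix.mulVec_mulVec, Matrix.dotProduct_mulVec _ (E.map Complex.ofReal)ᴴ,
      Matrix.dotProduct_mulVec _ (F.map Complex.ofReal)ᴴ, ← Matrix.star_mulVec,
      ← Matrix.star_mulVec, hEz, hFz, ← h3] at h1
    linarith
  -- The upper left block of the solved inequality is a Lyapunov inequality for `P`.
  have hPpos : P.PosDef := by
    rw [← posDef_map_ofReal_iff]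
    have hPc : (P.map Complex.ofReal).IsHermitian := by
      rw [Matrix.IsHermitian, map_ofReal_conjTranspose, hP.eq]
    have hH : (-((M.map Complex.ofReal)ᴴ * P.map Complex.ofReal +
        P.map Complex.ofReal * M.map Complex.ofReal)).IsHermitian := by
      rw [Matrix.IsHermitian, Matrix.conjTranspose_neg, Matrix.conjTranspose_add,
        Matrix.conjTranspose_mul, Matrix.conjTranspose_mul, Matrix.conjTranspose_conjTranspose,
        hPc.eq, add_comm]
    refine posDef_of_lyapunov hM hPc (.of_dotProduct_mulVec_pos hH fun {x} hx => ?_)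
    rw [Complex.pos_iff]
    refine ⟨?_, (hH.im_star_dotProduct_mulVec_self x).symm⟩
    have h1 := hQz x 0 fun h0 => hx (by
      have := congrArg (· ∘ Sum.inl) h0
      simpa using this)
    have h2 := re_star_dotProduct_transpose_mulVec P x (M.map Complex.ofReal *ᵥ x)
    rw [hP.eq] at h2
    rw [Matrix.mulVec_zero, add_zero, dotProduct_zero, Complex.zero_re] at h1
    have h3 := mul_nonneg (inv_nonneg.2 hγ.le)
      (re_star_dotProduct_self_nonneg (C.map Complex.ofReal *ᵥ x))
    rw [Matrix.neg_mulVec, dotProduct_neg, Complex.neg_re, Matrix.add_mulVec, dotProduct_add,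
      Complex.add_re, ← Matrix.mulVec_mulVec, ← Matrix.mulVec_mulVec,
      Matrix.dotProduct_mulVec _ (M.map Complex.ofReal)ᴴ, ← Matrix.star_mulVec, ← h2]
    linarith
  refine ⟨P⁻¹, hPpos.inv, ?_⟩
  rw [← posDef_map_ofReal_iff]
  have hneg : (-(boundedRealMatrix M B C γ P⁻¹)).map Complex.ofReal =
      -(boundedRealMatrix M B C γ P⁻¹).map Complex.ofReal := by
    ext i j
    simp
  have hH : (-(boundedRealMatrix M B C γ P⁻¹).map Complex.ofReal).IsHermitian := by
    rw [Matrix.IsHermitian, Matrix.conjTranspose_neg, map_ofReal_conjTranspose,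
      (isSymm_boundedRealMatrix M B C γ P⁻¹).eq]
  rw [hneg]
  refine .of_dotProduct_mulVec_pos hH fun {v} hv => ?_
  rw [Complex.pos_iff]
  refine ⟨?_, (hH.im_star_dotProduct_mulVec_self v).symm⟩
  obtain ⟨w, b, rfl⟩ : ∃ w b, v = Sum.elim w b := ⟨_, _, (Sum.elim_comp_inl_inr v).symm⟩
  obtain ⟨u, a, rfl⟩ : ∃ u a, w = Sum.elim u a := ⟨_, _, (Sum.elim_comp_inl_inr w).symm⟩
  rw [Matrix.neg_mulVec, dotProduct_neg, Complex.neg_re, re_boundedRealMatrix_form]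
  set x := (P⁻¹).map Complex.ofReal *ᵥ u with hx
  -- The congruence by `X = P⁻¹` passes from the form in `P` to the form in `X`.
  have hu : u = P.map Complex.ofReal *ᵥ x := by
    rw [hx, Matrix.mulVec_mulVec, ← map_ofReal_mul,
      Matrix.mul_nonsing_inv _ ((Matrix.isUnit_iff_isUnit_det _).1 hPpos.isUnit),
      Matrix.map_one _ Complex.ofReal_zero Complex.ofReal_one, Matrix.one_mulVec]
  have h1 : (star u ⬝ᵥ (M.map Complex.ofReal *ᵥ x + B.map Complex.ofReal *ᵥ a)).re =
      (star x ⬝ᵥ P.map Complex.ofReal *ᵥ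
        (M.map Complex.ofReal *ᵥ x + B.map Complex.ofReal *ᵥ a)).re := by
    rw [hu, Matrix.star_mulVec, ← Matrix.dotProduct_mulVec, map_ofReal_conjTranspose, hP.eq]
  rw [h1]
  clear_value x
  by_cases hxa : Sum.elim x a = 0
  · have hx0 : x = 0 := by simpa using congrArg (· ∘ Sum.inl) hxa
    have ha0 : a = 0 := by simpa using congrArg (· ∘ Sum.inr) hxa
    subst hx0 ha0
    rw [Matrix.mulVec_zero] at hu
    subst hu
    have hb : b ≠ 0 := by
      rintro rfl
      exact hv (by ext i; rcases i with (i | i) | i <;> rfl)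
    have := mul_pos hγ (re_star_dotProduct_self_pos hb)
    simpa using this
  · have h2 := hQz x a hxa
    have h3 := two_mul_re_star_dotProduct_le hγ b (C.map Complex.ofReal *ᵥ x)
    linarith

end BoundedReal

/-! ### State feedback synthesis -/

namespace LinSystem

variable {ν μ δ κ : Type*} [Fintype ν] [Fintype μ] [DecidableEq δ] [DecidableEq κ]

/-- The substitution `W = K X` turns the synthesis inequality into the bounded real inequality of the
closed loop. -/
theorem lmiMatrix_mul (S : LinSystem ν μ δ κ) (γ : ℝ) (X : Matrix ν ν ℝ) (K : Matrix μ ν ℝ) :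
    S.lmiMatrix γ X (K * X) =
      boundedRealMatrix (S.A + S.B₁ * K) S.B₂ (S.C + S.D₁ * K) γ X := by
  have h1 : S.Psi X (K * X) =
      ((S.A + S.B₁ * K) * X)ᵀ + (S.A + S.B₁ * K) * X := by
    rw [Psi, Matrix.add_mul, Matrix.mul_assoc, add_assoc]
  have h2 : S.C * X + S.D₁ * (K * X) = (S.C + S.D₁ * K) * X := by
    rw [Matrix.add_mul, Matrix.mul_assoc]
  rw [lmiMatrix, h1, h2, boundedRealMatrix]

variable [DecidableEq ν] [Fintype δ] [Fintype κ]

theorem Feasible.solves {S : LinSystem ν μ δ κ} {γ : ℝ} (hγ : 0 < γ) {X : Matrix ν ν ℝ}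
    {W : Matrix μ ν ℝ} (h : S.Feasible γ X W) : S.Solves γ (W * X⁻¹) := by
  obtain ⟨hX, hL⟩ := h
  have hW : W = W * X⁻¹ * X := by
    rw [Matrix.mul_assoc, Matrix.nonsing_inv_mul _ ((Matrix.isUnit_iff_isUnit_det _).1 hX.isUnit),
      Matrix.mul_one]
  rw [hW, lmiMatrix_mul] at hL
  refine ⟨isHurwitz_of_boundedRealMatrix hX hL, ?_⟩
  obtain ⟨c, hc, hle⟩ := exists_sigmaMax_le_of_boundedRealMatrix hγ hX hL
  refine lt_of_le_of_lt (iSup_le fun ω => ENNReal.ofReal_le_ofReal (hle ω)) ?_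
  exact (ENNReal.ofReal_lt_ofReal_iff hγ).2 hc

theorem Solves.exists_feasible {S : LinSystem ν μ δ κ} {γ : ℝ} (hγ : 0 < γ) {K : Matrix μ ν ℝ}
    (h : S.Solves γ K) : ∃ X W, S.Feasible γ X W := by
  obtain ⟨hM, hG⟩ := h
  obtain ⟨X, hX, hL⟩ := exists_boundedRealMatrix_of_sigmaMax_lt (M := S.A + S.B₁ * K) (B := S.B₂)
    (C := S.C + S.D₁ * K) hγ hM fun ω =>
      (ENNReal.ofReal_lt_ofReal_iff hγ).1 ((le_iSup
        (fun ω : ℝ => ENNReal.ofReal (sigmaMax (S.transfer K (Complex.I * (ω : ℂ))))) ω).trans_lt hG)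
  exact ⟨X, K * X, hX, by rwa [lmiMatrix_mul]⟩

theorem exists_solves_iff (S : LinSystem ν μ δ κ) {γ : ℝ} (hγ : 0 < γ) :
    (∃ K, S.Solves γ K) ↔ ∃ X W, S.Feasible γ X W :=
  ⟨fun ⟨_, hK⟩ => hK.exists_feasible hγ, fun ⟨_, _, h⟩ => ⟨_, h.solves hγ⟩⟩

theorem iInf_hinfNorm_eq (S : LinSystem ν μ δ κ) :
    (⨅ (K) (_ : S.IsStabilizing K), hinfNorm (S.transfer K)) =
      ⨅ (γ : ℝ) (_ : 0 < γ ∧ ∃ X W, S.Feasible γ X W), ENNReal.ofReal γ := by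
  apply le_antisymm
  · refine le_iInf₂ fun γ ⟨hγ, hfeas⟩ => ?_
    obtain ⟨K, hK, hlt⟩ := (S.exists_solves_iff hγ).2 hfeas
    exact (iInf₂_le K hK).trans hlt.le
  · refine le_iInf₂ fun K hK => le_of_forall_gt_imp_ge_of_dense fun b hb => ?_
    -- A level above the norm of the closed loop is feasible; `c` is finite because `c < b`.
    obtain ⟨c, hc, hcb⟩ := exists_between hb
    have hc_top : c ≠ ⊤ := (hcb.trans_le le_top).ne
    have hc0 : 0 < c.toReal := ENNReal.toReal_pos (bot_le.trans_lt hc).ne' hc_top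
    have hsol : S.Solves c.toReal K := ⟨hK, by rwa [ENNReal.ofReal_toReal hc_top]⟩
    refine (iInf₂_le c.toReal ⟨hc0, hsol.exists_feasible hc0⟩).trans ?_
    rw [ENNReal.ofReal_toReal hc_top]
    exact hcb.le

end LinSystem

end HinfControl

theorem theorem1 {n m w p q f r : Type*}
    [Fintype n] [DecidableEq n] [Fintype m] [Fintype w] [DecidableEq w]
    [Fintype p] [DecidableEq p] [Fintype q]
    [Fintype f] [DecidableEq f] [Fintype r] [DecidableEq r]
    (A : Matrix n n ℝ) (B₁ : Matrix n m ℝ) (B₂ : Matrix n w ℝ) (C : Matrix p n ℝ)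
    (CQ : Matrix q p ℝ) (Aω : Matrix f f ℝ) (Bω : Matrix f q ℝ)
    (Cω : Matrix r f ℝ) (Dω : Matrix r q ℝ) (D₁ : Matrix (p ⊕ r) m ℝ)
    (S : HinfControl.LinSystem ((n ⊕ f) ⊕ p) m (w ⊕ p) (p ⊕ r))
    (hS : S = HinfControl.augmented A B₁ B₂ C CQ Aω Bω Cω Dω D₁) :
    (∀ γ : ℝ, 0 < γ → ((∃ K, S.Solves γ K) ↔ ∃ X W, S.Feasible γ X W)) ∧
    (∀ γ : ℝ, 0 < γ → ∀ X W, S.Feasible γ X W → S.Solves γ (W * X⁻¹)) ∧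
    (⨅ (K) (_ : S.IsStabilizing K), HinfControl.hinfNorm (S.transfer K)) =
      ⨅ (γ : ℝ) (_ : 0 < γ ∧ ∃ X W, S.Feasible γ X W), ENNReal.ofReal γ := by
  exact ⟨fun _ hγ => S.exists_solves_iff hγ, fun _ hγ _ _ h => h.solves hγ, S.iInf_hinfNorm_eq⟩
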